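/- Let $n\ge 4$ and let $\Omega_n=\{1<2<\dots<n\}$. A partial permutation of $\Omega_n$ is an injective map from a subset $\operatorname{dom}(\alpha)$ of $\Omega_n$ into $\Omega_n$; partial permutations form a monoid under composition of partial maps. Let $C_n$ be the cycle graph with vertex set $\Omega_n$ and edges $\{i,i+1\}$ $(1\le i\le n-1)$ and $\{1,n\}$, and let $\mathrm{d}$ be its graph distance. Let $\mathcal{DI}_n$ be the monoid of all partial isometries of $C_n$, that is, of all partial permutations $\alpha$ of $\Omega_n$ such that $\mathrm{d}(x\alpha,y\alpha)=\mathrm{d}(x,y)$ for all $x,y\in\operatorname{dom}(\alpha)$. A partial permutation $\alpha$ is order-preserving (respectively, order-reversing) if $x\le y$ implies $x\alpha\le y\alpha$ (respectively, $x\alpha\ge y\alpha$) for all $x,y\in\operatorname{dom}(\alpha)$; it is monotone if it is order-preserving or order-reversing. If $\operatorname{dom}(\alpha)=\{a_1<\dots<a_t\}$, then $\alpha$ is orientation-preserving if there is at most one index $i\in\{1,\dots,t\}$ such that $a_i\alpha>a_{i+1}\alpha$, where $a_{t+1}=a_1$. Let $\mathcal{ODI}_n$, $\mathcal{MDI}_n$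 and $\mathcal{OPDI}_n$ be the submonoids of $\mathcal{DI}_n$ consisting of its order-preserving, its monotone and its orientation-preserving elements, respectively. The rank of a finite monoid $M$ is the minimum size of a subset that generates $M$ as a monoid (so the identity is the empty product). Theorem. For every $n\ge 4$, the monoids $\mathcal{ODI}_n$, $\mathcal{MDI}_n$ and $\mathcal{OPDI}_n$ have ranks $$n+2\left\lfloor\tfrac{n-1}{2}\right\rfloor,\qquad 2+3\left\lfloor\tfrac{n-1}{2}\right\rfloor\qquad\text{and}\qquad 2+\left\lfloor\tfrac{n-1}{2}\right\rfloor,$$ respectively. -/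

import Mathlib

/-! Partial permutations act on the right: `α * β` means "first `α`, then `β`".
Mathlib's `PEquiv` (notation `V ≃. V`) is the type of partial permutations of `V`:
`α x = some y` says that `x` lies in the domain of `α` and is sent to `y`. -/

/-- The symmetric inverse monoid on `V`: partial permutations under composition
of partial maps, with the identity map as unit. -/
instance PEquiv.instMonoidSelf {V : Type*} : Monoid (V ≃. V) where
  mul α β := α.trans β
  one := PEquiv.refl V
  mul_assoc α β γ := PEquiv.trans_assoc α β γ
  one_mul α := PEquiv.refl_trans α
  mul_one α := PEquiv.trans_refl α

theorem PEquiv.one_eq_some_iff {V : Type*} (x y : V) :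
    (1 : V ≃. V) x = some y ↔ x = y := by
  change some x = some y ↔ x = y
  simp

theorem PEquiv.mul_eq_some_iff {V : Type*} (α β : V ≃. V) (x z : V) :
    (α * β) x = some z ↔ ∃ y, α x = some y ∧ β y = some z := by
  change (α x).bind β = some z ↔ _
  simp [Option.bind_eq_some_iff]

/-- The monoid of all partial isometries of a (connected) graph `G`, i.e. of all partial
permutations `α` of the vertices with `d(xα, yα) = d(x, y)` for all `x, y ∈ dom α`. -/
def partialIsometryMonoid {V : Type*} (G : SimpleGraph V) : Submonoid (V ≃. V) where
  carrier := {α | ∀ x y x' y', α x = some x' → α y = some y' → G.dist x' y' = G.dist x y}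
  one_mem' := by
    intro x y x' y' hx hy
    rw [PEquiv.one_eq_some_iff] at hx hy
    rw [hx, hy]
  mul_mem' := by
    intro α β hα hβ x y x' y' hx hy
    rw [PEquiv.mul_eq_some_iff] at hx hy
    obtain ⟨u, hu, hx⟩ := hx
    obtain ⟨v, hv, hy⟩ := hy
    rw [hβ u v x' y' hx hy, hα x y u v hu hv]

/-- `DI n`: the monoid of all partial isometries of the cycle graph with `n` vertices
(the vertices are `0 < 1 < ⋯ < n - 1` instead of `1 < 2 < ⋯ < n`). -/
def DI (n : ℕ) : Submonoid (Fin n ≃. Fin n) :=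
  partialIsometryMonoid (SimpleGraph.cycleGraph n)

/-- `x ≤ y` implies `xα ≤ yα` on the domain of `α`. -/
def OrderPreserving {n : ℕ} (α : Fin n ≃. Fin n) : Prop :=
  ∀ x y x' y', α x = some x' → α y = some y' → x ≤ y → x' ≤ y'

/-- `x ≤ y` implies `xα ≥ yα` on the domain of `α`. -/
def OrderReversing {n : ℕ} (α : Fin n ≃. Fin n) : Prop :=
  ∀ x y x' y', α x = some x' → α y = some y' → x ≤ y → y' ≤ x'

/-- A sequence `(s₁, …, s_t)` is cyclic if there is at most one index `i` with
`sᵢ > sᵢ₊₁`, where `s_{t+1}` means `s₁`; `finRotate t` sends each index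
to the next one and the last index to the first. -/
def CyclicSeq {n t : ℕ} (s : Fin t → Fin n) : Prop :=
  ∀ i j, s i > s (finRotate t i) → s j > s (finRotate t j) → i = j

/-- `α` is orientation-preserving: if `dom α = {a₁ < ⋯ < a_t}`, then the
sequence of images `(a₁α, …, a_tα)` is cyclic. -/
def OrientationPreserving {n : ℕ} (α : Fin n ≃. Fin n) : Prop :=
  ∀ (t : ℕ) (a b : Fin t → Fin n), StrictMono a →
    (∀ x, (α x).isSome ↔ x ∈ Set.range a) → (∀ i, α (a i) = some (b i)) → CyclicSeq b

/-- The monoid of all order-preserving partial permutations of an `n`-element chain. -/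
def POI (n : ℕ) : Submonoid (Fin n ≃. Fin n) where
  carrier := {α | OrderPreserving α}
  one_mem' := by
    intro x y x' y' hx hy h
    rw [PEquiv.one_eq_some_iff] at hx hy
    rwa [← hx, ← hy]
  mul_mem' := by
    intro α β hα hβ x y x' y' hx hy h
    rw [PEquiv.mul_eq_some_iff] at hx hy
    obtain ⟨u, hu, hx⟩ := hx
    obtain ⟨v, hv, hy⟩ := hy
    exact hβ u v x' y' hx hy (hα x y u v hu hv h)

/-- The monoid of all monotone (that is, order-preserving or order-reversing) partial
permutations of an `n`-element chain. -/
def PODI (n : ℕ) : Submonoid (Fin n ≃. Fin n) where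
  carrier := {α | OrderPreserving α ∨ OrderReversing α}
  one_mem' := Or.inl (POI n).one_mem
  mul_mem' := by
    rintro α β (hα | hα) (hβ | hβ)
    · exact Or.inl ((POI n).mul_mem hα hβ)
    all_goals
      first
        | refine Or.inr fun x y x' y' hx hy h => ?_
          rw [PEquiv.mul_eq_some_iff] at hx hy
          obtain ⟨u, hu, hx⟩ := hx
          obtain ⟨v, hv, hy⟩ := hy
          first
            | exact hβ u v x' y' hx hy (hα x y u v hu hv h)
            | exact hβ v u y' x' hy hx (hα x y u v hu hv h)
        | refine Or.inl fun x y x' y' hx hy h => ?_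
          rw [PEquiv.mul_eq_some_iff] at hx hy
          obtain ⟨u, hu, hx⟩ := hx
          obtain ⟨v, hv, hy⟩ := hy
          exact hβ v u y' x' hy hx (hα x y u v hu hv h)

/-- `p, q, r` occur in this cyclic order. -/
def CycTriple {n : ℕ} (p q r : Fin n) : Prop :=
  (p < q ∧ q < r) ∨ (q < r ∧ r < p) ∨ (r < p ∧ p < q)

/-- If a sequence strictly decreases from index `i` to a later index `j`, then it has a
descent between consecutive indices in between. -/
theorem exists_descent (f : ℕ → ℕ) (i j : ℕ) (hij : i ≤ j) (h : f j < f i) :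
    ∃ k, i ≤ k ∧ k < j ∧ f (k + 1) < f k := by
  induction j, hij using Nat.le_induction with
  | base => exact absurd h (lt_irrefl _)
  | succ m hm ih =>
    by_cases h1 : f m < f i
    · obtain ⟨k, h2, h3, h4⟩ := ih h1
      exact ⟨k, h2, by omega, h4⟩
    · exact ⟨m, hm, by omega, by omega⟩

theorem finRotate_val_of_lt {t : ℕ} (i : Fin t) (h : i.1 + 1 < t) :
    (finRotate t i).1 = i.1 + 1 := by
  cases t with
  | zero => exact i.elim0
  | succ m => rw [coe_finRotate_of_ne_last (by intro e; subst e; simp at h)]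

theorem finRotate_val_of_eq {t : ℕ} (i : Fin t) (h : i.1 + 1 = t) :
    (finRotate t i).1 = 0 := by
  cases t with
  | zero => exact i.elim0
  | succ m =>
    have : i = Fin.last m := Fin.ext (by simp; omega)
    subst this
    simp

theorem finRotate_mod {t : ℕ} (ht : 0 < t) (m : ℕ) :
    finRotate t ⟨m % t, Nat.mod_lt m ht⟩ = ⟨(m + 1) % t, Nat.mod_lt _ ht⟩ := by
  apply Fin.ext
  have hm := Nat.mod_lt m ht
  by_cases h : m % t + 1 < t
  · rw [finRotate_val_of_lt _ h]
    change m % t + 1 = (m + 1) % t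
    rw [← Nat.mod_add_mod, Nat.mod_eq_of_lt h]
  · have h' : m % t + 1 = t := by omega
    rw [finRotate_val_of_eq _ h']
    change 0 = (m + 1) % t
    rw [← Nat.mod_add_mod, h', Nat.mod_self]

theorem CycTriple.rotate {n : ℕ} {p q r : Fin n} (h : CycTriple p q r) : CycTriple q r p := by
  unfold CycTriple at *
  tauto

/-- For sequences without repetitions, being cyclic can be tested on triples. -/
theorem cyclicSeq_iff {n t : ℕ} (s : Fin t → Fin n) (hs : Function.Injective s) :
    CyclicSeq s ↔ ∀ i j k, i < j → j < k → CycTriple (s i) (s j) (s k) := by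
  constructor
  · intro h i j k hij hjk
    have ht : 0 < t := by have := i.2; omega
    have hmod : ∀ x : Fin t, (⟨x.1 % t, Nat.mod_lt _ ht⟩ : Fin t) = x :=
      fun x => Fin.ext (Nat.mod_eq_of_lt x.2)
    have hmod' : (⟨(i.1 + t) % t, Nat.mod_lt _ ht⟩ : Fin t) = i :=
      Fin.ext (by simp [Nat.mod_eq_of_lt i.2])
    let f : ℕ → ℕ := fun m => (s ⟨m % t, Nat.mod_lt m ht⟩).1
    have fi : f i.1 = s i := by simp only [f, hmod]
    have fj : f j.1 = s j := by simp only [f, hmod]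
    have fk : f k.1 = s k := by simp only [f, hmod]
    have fit : f (i.1 + t) = s i := by simp only [f, hmod']
    have key : ∀ m m' : ℕ, f (m + 1) < f m → f (m' + 1) < f m' → i.1 ≤ m → m < m' →
        m' < i.1 + t → False := by
      intro m m' h1 h2 h3 h4 h5
      have e := h ⟨m % t, Nat.mod_lt m ht⟩ ⟨m' % t, Nat.mod_lt m' ht⟩
        (by rw [finRotate_mod ht]; exact h1) (by rw [finRotate_mod ht]; exact h2)
      have e : m % t = m' % t := congrArg Fin.val e
      have hd : t ∣ m' - m := (Nat.modEq_iff_dvd' h4.le).1 e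
      have := Nat.le_of_dvd (by omega) hd
      omega
    have nij : s i ≠ s j := fun e => hij.ne (hs e)
    have njk : s j ≠ s k := fun e => hjk.ne (hs e)
    have nik : s i ≠ s k := fun e => (hij.trans hjk).ne (hs e)
    have hk := k.2
    rw [Fin.lt_def] at hij hjk
    have d1 : s j < s i → ∃ m, i.1 ≤ m ∧ m < j.1 ∧ f (m + 1) < f m := fun hh =>
      exists_descent f _ _ hij.le (by rw [fi, fj]; exact hh)
    have d2 : s k < s j → ∃ m, j.1 ≤ m ∧ m < k.1 ∧ f (m + 1) < f m := fun hh =>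
      exists_descent f _ _ hjk.le (by rw [fj, fk]; exact hh)
    have d3 : s i < s k → ∃ m, k.1 ≤ m ∧ m < i.1 + t ∧ f (m + 1) < f m := fun hh =>
      exists_descent f _ _ (by omega) (by rw [fit, fk]; exact hh)
    have n12 : ¬ (s j < s i ∧ s k < s j) := by
      rintro ⟨h1, h2⟩
      obtain ⟨m, _, _, hm⟩ := d1 h1
      obtain ⟨m', _, _, hm'⟩ := d2 h2
      exact key m m' hm hm' (by omega) (by omega) (by omega)
    have n13 : ¬ (s j < s i ∧ s i < s k) := by
      rintro ⟨h1, h2⟩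
      obtain ⟨m, _, _, hm⟩ := d1 h1
      obtain ⟨m', _, _, hm'⟩ := d3 h2
      exact key m m' hm hm' (by omega) (by omega) (by omega)
    have n23 : ¬ (s k < s j ∧ s i < s k) := by
      rintro ⟨h1, h2⟩
      obtain ⟨m, _, _, hm⟩ := d2 h1
      obtain ⟨m', _, _, hm'⟩ := d3 h2
      exact key m m' hm hm' (by omega) (by omega) (by omega)
    clear d1 d2 d3 key hmod hmod' fi fj fk fit
    unfold CycTriple
    omega
  · intro h
    have main : ∀ i j : Fin t, s i > s (finRotate t i) → s j > s (finRotate t j) →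
        i < j → False := by
      intro i j hi hj hij
      have hj2 := j.2
      rw [Fin.lt_def] at hij
      have e1 : (finRotate t i).1 = i.1 + 1 := finRotate_val_of_lt i (by omega)
      have e2 : (finRotate t j).1 = j.1 + 1 ∨ (finRotate t j).1 = 0 := by
        by_cases hh : j.1 + 1 < t
        · exact Or.inl (finRotate_val_of_lt j hh)
        · exact Or.inr (finRotate_val_of_eq j (by omega))
      generalize finRotate t i = i' at *
      generalize finRotate t j = j' at *
      have a1 : s j ≤ s i := by
        by_cases hh : i' = j
        · rw [← hh]; exact hi.le
        · have := h i i' j (Fin.lt_def.2 (by omega))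
            (Fin.lt_def.2 (by have : i'.1 ≠ j.1 := fun e => hh (Fin.ext e); omega))
          unfold CycTriple at this
          omega
      rcases e2 with e2 | e2
      · have := h i j j' (Fin.lt_def.2 hij) (Fin.lt_def.2 (by omega))
        unfold CycTriple at this
        omega
      · by_cases hh : j' = i
        · subst hh
          omega
        · have := h j' i j
            (Fin.lt_def.2 (by have : j'.1 ≠ i.1 := fun e => hh (Fin.ext e); omega))
            (Fin.lt_def.2 hij)
          unfold CycTriple at this
          omega
    intro i j hi hj
    rcases lt_trichotomy i j with hij | hij | hij
    · exact (main i j hi hj hij).elim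
    · exact hij
    · exact (main j i hj hi hij).elim

/-- A partial permutation is orientation-preserving if and only if it preserves the cyclic
order of triples of its domain. -/
theorem orientationPreserving_iff {n : ℕ} (α : Fin n ≃. Fin n) :
    OrientationPreserving α ↔ ∀ x y z x' y' z', α x = some x' → α y = some y' →
      α z = some z' → CycTriple x y z → CycTriple x' y' z' := by
  have inj : ∀ (t : ℕ) (a b : Fin t → Fin n), StrictMono a →
      (∀ i, α (a i) = some (b i)) → Function.Injective b := by
    intro t a b ha hb i j hij
    have h1 := hb i
    rw [hij] at h1
    exact ha.injective (α.inj (Option.mem_def.2 h1) (Option.mem_def.2 (hb j)))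
  constructor
  · intro h
    have main : ∀ x y z x' y' z', α x = some x' → α y = some y' → α z = some z' →
        x < y → y < z → CycTriple x' y' z' := by
      intro x y z x' y' z' hx hy hz hxy hyz
      let D : Finset (Fin n) := Finset.univ.filter fun u => (α u).isSome
      let a := D.orderEmbOfFin rfl
      have hr : ∀ u, (α u).isSome ↔ u ∈ Set.range a := by
        intro u
        rw [Finset.range_orderEmbOfFin]
        simp [D]
      have hb : ∀ i, ∃ v, α (a i) = some v := fun i =>
        Option.isSome_iff_exists.1 ((hr _).2 ⟨i, rfl⟩)
      choose b hb using hb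
      have hc := (cyclicSeq_iff b (inj _ a b a.strictMono hb)).1
        (h _ a b a.strictMono hr hb)
      obtain ⟨i, rfl⟩ := (hr x).1 (by simp [hx])
      obtain ⟨j, rfl⟩ := (hr y).1 (by simp [hy])
      obtain ⟨k, rfl⟩ := (hr z).1 (by simp [hz])
      have := hc i j k (a.lt_iff_lt.1 hxy) (a.lt_iff_lt.1 hyz)
      rw [hb, Option.some.injEq] at hx hy hz
      rwa [hx, hy, hz] at this
    rintro x y z x' y' z' hx hy hz (⟨h1, h2⟩ | ⟨h1, h2⟩ | ⟨h1, h2⟩)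
    · exact main _ _ _ _ _ _ hx hy hz h1 h2
    · exact (main _ _ _ _ _ _ hy hz hx h1 h2).rotate.rotate
    · exact (main _ _ _ _ _ _ hz hx hy h1 h2).rotate
  · intro h t a b ha hr hb
    refine (cyclicSeq_iff b (inj t a b ha hb)).2 fun i j k hij hjk => ?_
    exact h _ _ _ _ _ _ (hb i) (hb j) (hb k) (Or.inl ⟨ha hij, ha hjk⟩)

/-- The monoid of all orientation-preserving partial permutations of an `n`-element
chain. -/
def POPI (n : ℕ) : Submonoid (Fin n ≃. Fin n) where
  carrier := {α | OrientationPreserving α}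
  one_mem' := by
    refine (orientationPreserving_iff _).2 fun x y z x' y' z' hx hy hz h => ?_
    rw [PEquiv.one_eq_some_iff] at hx hy hz
    rwa [← hx, ← hy, ← hz]
  mul_mem' := by
    intro α β hα hβ
    refine (orientationPreserving_iff _).2 fun x y z x' y' z' hx hy hz h => ?_
    rw [PEquiv.mul_eq_some_iff] at hx hy hz
    obtain ⟨u, hu, hx⟩ := hx
    obtain ⟨v, hv, hy⟩ := hy
    obtain ⟨w, hw, hz⟩ := hz
    exact (orientationPreserving_iff _).1 hβ _ _ _ _ _ _ hx hy hz
      ((orientationPreserving_iff _).1 hα _ _ _ _ _ _ hu hv hw h)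

/-- The monoid of all order-preserving partial isometries of the cycle graph. -/
def ODI (n : ℕ) : Submonoid (Fin n ≃. Fin n) := DI n ⊓ POI n

/-- The monoid of all monotone partial isometries of the cycle graph. -/
def MDI (n : ℕ) : Submonoid (Fin n ≃. Fin n) := DI n ⊓ PODI n

/-- The monoid of all orientation-preserving partial isometries of the cycle graph. -/
def OPDI (n : ℕ) : Submonoid (Fin n ≃. Fin n) := DI n ⊓ POPI n

/-- The monoid `M` has rank `k`: `k` is the minimum size of a set that generates `M` as a
monoid. -/
def HasMonoidRank (M : Type*) [Monoid M] (k : ℕ) : Prop :=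
  IsLeast {m : ℕ | ∃ S : Finset M, S.card = m ∧ Submonoid.closure (S : Set M) = ⊤} k

/-! An isometry of the cycle turns the linear distance `d` of two points into `d` or `n - d`. Three
domain points leave no freedom: a monotone isometry then keeps all linear distances
(`dist_eq_of_monotone_of_three`), and an orientation-preserving one acts as a rotation
(`rotationPair_of_three`). Hence an order-preserving isometry is a restriction of a translation, or
has a two-point domain whose distance `i` becomes `n - i ≠ i`. Monotone elements are these, possibly
followed by the reversal. Orientation-preserving elements are restrictions of rotations, or
two-point maps that reverse an arc.

Upper bounds. Restrictions come from the idempotents that omit one point (`mem_of_le`), so it is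
enough to generate these idempotents, the translations or rotations, and one flip for each distance.
Conjugation by units reduces the number of idempotents, and the shifts by `±1` produce the
idempotents omitting an endpoint.

Lower bounds. If the complement of a set is closed under products and contains `1`, every generating
set meets that set as soon as the monoid does. Pairwise disjoint sets of this kind bound the rank
from below (`hasMonoidRank_of_family`). They are: the non-identity total maps; for each set `K` of
points stable under the total maps, the maps whose domain omits exactly one point, lying in `K`; for
each distance, the maps that flip it. Disjointness holds because a flip leaves no room for a third
domain point, whereas `4 ≤ n` provides one when at most one point is omitted.

Put `m = (n - 1) / 2`. Order-preserving: `n` omitted points and `2 * m` distances `i ≠ n - i`.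
Monotone: the reversal, `m + 1` orbits of points under it, and `2 * m` distances.
Orientation-preserving: the rotation, one orbit, and `m` distances, as `i` and `n - i` describe the
same pairs up to rotation. -/

/-! ### Distance in the cycle graph -/

theorem cycleGraph_adj_iff_val {n : ℕ} (hn : 2 ≤ n) (u v : Fin n) :
    (SimpleGraph.cycleGraph n).Adj u v ↔
      u.1 + 1 = v.1 ∨ v.1 + 1 = u.1 ∨ u.1 + 1 = v.1 + n ∨ v.1 + 1 = u.1 + n := by
  have key : ∀ a b : Fin n, (a - b).val = 1 ↔ b.1 + 1 = a.1 ∨ b.1 + 1 = a.1 + n := by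
    intro a b
    rw [Fin.val_sub]
    have ha := a.2
    have hb := b.2
    by_cases h : b.1 ≤ a.1
    · rw [Nat.mod_eq_sub_mod (by omega), Nat.mod_eq_of_lt (by omega)]
      omega
    · rw [Nat.mod_eq_of_lt (by omega)]
      omega
  rw [SimpleGraph.cycleGraph_adj', key, key]
  tauto

/-- The two arcs between the points give walks of both lengths, the outer one through the edge from
`0` to the last vertex. Conversely, one edge changes the minimum by at most one, so no walk is
shorter. -/
theorem cycleGraph_dist {n : ℕ} (hn : 2 ≤ n) (u v : Fin n) :
    (SimpleGraph.cycleGraph n).dist u v = min (Nat.dist u v) (n - Nat.dist u v) := by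
  obtain ⟨k, rfl⟩ : ∃ k, n = k + 1 := ⟨n - 1, by omega⟩
  have conn := SimpleGraph.cycleGraph_connected (n := k)
  set G := SimpleGraph.cycleGraph (k + 1)
  have path : ∀ (m : ℕ) (u v : Fin (k + 1)), u.1 + m = v.1 → G.dist u v ≤ m := by
    intro m
    induction m with
    | zero =>
      intro u v h
      obtain rfl : u = v := Fin.ext h
      simp
    | succ m ih =>
      intro u v h
      have hv := v.2
      have h1 := ih u ⟨u.1 + m, by omega⟩ rfl
      have h2 : G.dist ⟨u.1 + m, by omega⟩ v = 1 :=
        SimpleGraph.dist_eq_one_iff_adj.2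
          ((cycleGraph_adj_iff_val hn _ _).2 (Or.inl (by simpa [add_assoc] using h)))
      have := conn.dist_triangle (u := u) (v := ⟨u.1 + m, by omega⟩) (w := v)
      omega
  have upper : ∀ u v : Fin (k + 1), u ≤ v →
      G.dist u v ≤ min (Nat.dist u v) (k + 1 - Nat.dist u v) := by
    intro u v h
    have hv := v.2
    have h0 := path (v.1 - u.1) u v (by omega)
    have h1 := path u.1 0 u (by simp)
    have h2 := path (k - v.1) v (Fin.last k) (by simp; omega)
    have h3 : G.dist 0 (Fin.last k) = 1 :=
      SimpleGraph.dist_eq_one_iff_adj.2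
        ((cycleGraph_adj_iff_val hn _ _).2 (Or.inr (Or.inr (Or.inr (by simp)))))
    have h4 := conn.dist_triangle (u := u) (v := 0) (w := v)
    have h5 := conn.dist_triangle (u := 0) (v := Fin.last k) (w := v)
    rw [SimpleGraph.dist_comm (u := u) (v := 0)] at h4
    rw [SimpleGraph.dist_comm (u := Fin.last k) (v := v)] at h5
    rw [Fin.le_def] at h
    unfold Nat.dist
    omega
  have lower : ∀ (u v : Fin (k + 1)) (p : G.Walk u v),
      min (Nat.dist u v) (k + 1 - Nat.dist u v) ≤ p.length := by
    intro u v p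
    induction p with
    | nil => simp
    | @cons u w v h p ih =>
      have h' := (cycleGraph_adj_iff_val hn _ _).1 h
      have hu := u.2
      have hv := v.2
      have hw := w.2
      rw [SimpleGraph.Walk.length_cons]
      unfold Nat.dist at *
      omega
  obtain ⟨p, hp⟩ := conn.exists_walk_length_eq_dist u v
  refine le_antisymm ?_ (hp ▸ lower u v p)
  rcases le_total u v with h | h
  · exact upper u v h
  · rw [SimpleGraph.dist_comm, Nat.dist_comm]
    exact upper v u h

theorem mem_DI_iff {n : ℕ} (hn : 2 ≤ n) (α : Fin n ≃. Fin n) :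
    α ∈ DI n ↔ ∀ x y x' y', α x = some x' → α y = some y' →
      Nat.dist x' y' = Nat.dist x y ∨ Nat.dist x' y' + Nat.dist x y = n := by
  change (∀ x y x' y', α x = some x' → α y = some y' → _ = _) ↔ _
  refine forall_congr' fun x => forall_congr' fun y => forall_congr' fun x' =>
    forall_congr' fun y' => forall_congr' fun _ => forall_congr' fun _ => ?_
  rw [cycleGraph_dist hn, cycleGraph_dist hn]
  have := x.2
  have := y.2
  have := x'.2
  have := y'.2
  unfold Nat.dist
  omega

/-! ### Rigidity on three points -/

theorem PEquiv.image_eq_iff {V : Type*} (α : V ≃. V) {x y x' y' : V} (hx : α x = some x')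
    (hy : α y = some y') : x' = y' ↔ x = y := by
  constructor
  · rintro rfl
    exact α.inj hx hy
  · rintro rfl
    exact Option.some.inj (hx.symm.trans hy)

/-- In a monotone partial isometry, no distance is changed if the domain has three points. -/
theorem dist_eq_of_monotone_of_three {n : ℕ} (hn : 2 ≤ n) {α : Fin n ≃. Fin n} (hα : α ∈ MDI n)
    {a b c a' b' c' : Fin n} (ha : α a = some a') (hb : α b = some b') (hc : α c = some c')
    (hac : a ≠ c) (hbc : b ≠ c) : Nat.dist a' b' = Nat.dist a b := by
  have hd := (mem_DI_iff hn α).1 hα.1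
  have h1 := hd _ _ _ _ ha hb
  have h2 := hd _ _ _ _ ha hc
  have h3 := hd _ _ _ _ hb hc
  have eab := α.image_eq_iff ha hb
  have eac := α.image_eq_iff ha hc
  have ebc := α.image_eq_iff hb hc
  rcases hα.2 with ho | ho
  all_goals
    have o1 := ho _ _ _ _ ha hb
    have o2 := ho _ _ _ _ hb ha
    have o3 := ho _ _ _ _ ha hc
    have o4 := ho _ _ _ _ hc ha
    have o5 := ho _ _ _ _ hb hc
    have o6 := ho _ _ _ _ hc hb
    clear ho hd hα
    rw [Fin.le_def, Fin.le_def] at o1 o2 o3 o4 o5 o6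
    rw [Fin.ext_iff, Fin.ext_iff] at eab eac ebc
    rw [Ne, Fin.ext_iff] at hac hbc
    unfold Nat.dist at *
    -- For three distinct points, the distance of the outer two is the sum of the other two
    -- distances, before and after the map. Turning any distance `d` into `n - d ≠ d` breaks this.
    rcases lt_trichotomy a.1 b.1 with h | h | h <;> rcases lt_or_gt_of_ne hac with h' | h' <;>
      rcases lt_or_gt_of_ne hbc with h'' | h'' <;> omega

/-- The pairs `(x, y)` and `(x', y')` differ by a rotation of the cycle. -/
def RotationPair {n : ℕ} (x y x' y' : Fin n) : Prop :=
  y'.1 + x.1 = y.1 + x'.1 ∨ y'.1 + x.1 + n = y.1 + x'.1 ∨ y'.1 + x.1 = y.1 + x'.1 + n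

/-- Both triples cut the cycle into three positive arcs of total length `n`, taken in the same
direction. Each arc is kept or replaced by its complement, and the total forces all three to be
kept. -/
theorem rotationPair_of_cycTriple {n : ℕ} {a b c a' b' c' : Fin n}
    (hab : Nat.dist a' b' = Nat.dist a b ∨ Nat.dist a' b' + Nat.dist a b = n)
    (hac : Nat.dist a' c' = Nat.dist a c ∨ Nat.dist a' c' + Nat.dist a c = n)
    (hbc : Nat.dist b' c' = Nat.dist b c ∨ Nat.dist b' c' + Nat.dist b c = n)
    (h : CycTriple a b c) (h' : CycTriple a' b' c') : RotationPair a b a' b' := by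
  have := a.2; have := b.2; have := c.2; have := a'.2; have := b'.2; have := c'.2
  unfold RotationPair
  unfold Nat.dist at *
  simp only [CycTriple, Fin.lt_def] at h h'
  rcases h with ⟨h1, h2⟩ | ⟨h1, h2⟩ | ⟨h1, h2⟩ <;>
    rcases h' with ⟨h3, h4⟩ | ⟨h3, h4⟩ | ⟨h3, h4⟩ <;> omega

theorem RotationPair.swap {n : ℕ} {x y x' y' : Fin n} (h : RotationPair x y x' y') :
    RotationPair y x y' x' := by
  unfold RotationPair at *
  omega

/-- An orientation-preserving partial isometry whose domain has three points acts on it as a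
rotation. -/
theorem rotationPair_of_three {n : ℕ} (hn : 2 ≤ n) {α : Fin n ≃. Fin n} (hα : α ∈ OPDI n)
    {a b c a' b' c' : Fin n} (ha : α a = some a') (hb : α b = some b') (hc : α c = some c')
    (hac : a ≠ c) (hbc : b ≠ c) : RotationPair a b a' b' := by
  have hd := (mem_DI_iff hn α).1 hα.1
  have ho := (orientationPreserving_iff α).1 hα.2
  by_cases hab : a = b
  · subst hab
    have := (α.image_eq_iff ha hb).2 rfl
    exact Or.inl (by omega)
  have h : CycTriple a b c ∨ CycTriple b a c := by
    unfold CycTriple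
    omega
  rcases h with h | h
  · exact rotationPair_of_cycTriple (hd _ _ _ _ ha hb) (hd _ _ _ _ ha hc) (hd _ _ _ _ hb hc) h
      (ho _ _ _ _ _ _ ha hb hc h)
  · exact (rotationPair_of_cycTriple (hd _ _ _ _ hb ha) (hd _ _ _ _ hb hc) (hd _ _ _ _ ha hc) h
      (ho _ _ _ _ _ _ hb ha hc h)).swap

/-! ### Rank from disjoint unavoidable sets -/

theorem Submonoid.closure_coe_eq_top_iff {G : Type*} [Monoid G] (M : Submonoid G) (S : Set M) :
    Submonoid.closure S = ⊤ ↔ Submonoid.closure (((↑) : M → G) '' S) = M := by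
  have h := MonoidHom.map_mclosure M.subtype S
  constructor
  · intro e
    rw [e, ← MonoidHom.mrange_eq_map, Submonoid.mrange_subtype] at h
    exact h.symm
  · intro e
    refine Submonoid.map_injective_of_injective (f := M.subtype) Subtype.val_injective ?_
    rw [h, ← MonoidHom.mrange_eq_map, Submonoid.mrange_subtype]
    exact e

/-- A generating family is of minimum size if its members lie in disjoint sets whose complements
are closed under multiplication. -/
theorem hasMonoidRank_of_family {G ι : Type*} [Monoid G] [Fintype ι] (M : Submonoid G)
    (gen : ι → G) (A : ι → Set G) (hgen : Submonoid.closure (Set.range gen) = M)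
    (mem : ∀ i, gen i ∈ A i) (one : ∀ i, 1 ∉ A i)
    (mul : ∀ i, ∀ a ∈ M, ∀ b ∈ M, a * b ∈ A i → a ∈ A i ∨ b ∈ A i)
    (disj : ∀ i j, ∀ a ∈ M, a ∈ A i → a ∈ A j → i = j) :
    HasMonoidRank M (Fintype.card ι) := by
  classical
  have hM : ∀ i, gen i ∈ M := fun i => hgen ▸ Submonoid.subset_closure ⟨i, rfl⟩
  have lower : ∀ S : Finset M, Submonoid.closure (S : Set M) = ⊤ → Fintype.card ι ≤ S.card := by
    intro S hS
    have ex : ∀ i, ∃ s ∈ S, s.1 ∈ A i := by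
      intro i
      by_contra! hno
      -- If `S` missed `A i`, it would lie in the complement of `A i`, a proper submonoid since it
      -- lacks `gen i`.
      let N : Submonoid M :=
        { carrier := {a | a.1 ∉ A i}
          one_mem' := one i
          mul_mem' := fun {a b} ha hb hab => (mul i a a.2 b b.2 hab).elim ha hb }
      have hN : Submonoid.closure (S : Set M) ≤ N := (Submonoid.closure_le).2 fun s hs => hno s hs
      exact hN (hS ▸ Submonoid.mem_top (⟨gen i, hM i⟩ : M)) (mem i)
    choose s hs hsA using ex
    rw [← Finset.card_univ]
    refine Finset.card_le_card_of_injOn s (fun i _ => hs i) fun i _ j _ hij => ?_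
    exact disj i j _ (s i).2 (hsA i) (hij ▸ hsA j)
  let T : Finset M := Finset.univ.image fun i => ⟨gen i, hM i⟩
  have hT : Submonoid.closure (T : Set M) = ⊤ := by
    rw [Submonoid.closure_coe_eq_top_iff]
    simpa [T, ← Set.range_comp, Function.comp_def] using hgen
  refine ⟨⟨T, le_antisymm Finset.card_image_le (lower T hT), hT⟩, ?_⟩
  rintro m ⟨S, rfl, hS⟩
  exact lower S hS

/-! ### The generators -/

theorem PEquiv.ext_some {V : Type*} {α β : V ≃. V}
    (h : ∀ x y, α x = some y ↔ β x = some y) : α = β :=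
  PEquiv.ext fun x => Option.ext fun y => h x y

open Classical in
/-- The partial permutation whose graph is the functional and injective relation `r`. -/
noncomputable def PEquiv.ofRel {V : Type*} (r : V → V → Prop)
    (functional : ∀ x y z, r x y → r x z → y = z)
    (injective : ∀ x y z, r x z → r y z → x = y) : V ≃. V where
  toFun x := if h : ∃ y, r x y then some h.choose else none
  invFun y := if h : ∃ x, r x y then some h.choose else none
  inv x y := by
    constructor
    · intro h
      split_ifs at h with hy
      have hx := hy.choose_spec
      rw [Option.some.inj h] at hx
      have ex : ∃ y, r x y := ⟨y, hx⟩
      rw [dif_pos ex, functional _ _ _ ex.choose_spec hx]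
    · intro h
      split_ifs at h with hx
      have hy := hx.choose_spec
      rw [Option.some.inj h] at hy
      have ex : ∃ x, r x y := ⟨x, hy⟩
      rw [dif_pos ex, injective _ _ _ ex.choose_spec hy]

open Classical in
theorem PEquiv.ofRel_eq_some_iff {V : Type*} {r : V → V → Prop}
    {functional : ∀ x y z, r x y → r x z → y = z}
    {injective : ∀ x y z, r x z → r y z → x = y} {x y : V} :
    PEquiv.ofRel r functional injective x = some y ↔ r x y := by
  change dite (∃ y, r x y) (fun h => some h.choose) (fun _ => none) = some y ↔ _
  constructor
  · intro h
    split_ifs at h with hx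
    exact Option.some.inj h ▸ hx.choose_spec
  · intro h
    have ex : ∃ y, r x y := ⟨y, h⟩
    rw [dif_pos ex, functional _ _ _ ex.choose_spec h]

/-- The identity map of `s`. -/
noncomputable def partialId {V : Type*} (s : Set V) : V ≃. V :=
  PEquiv.ofRel (fun x y => x = y ∧ x ∈ s) (by grind) (by grind)

/-- The partial translation `x ↦ x + j`. -/
noncomputable def shift (n : ℕ) (j : ℤ) : Fin n ≃. Fin n :=
  PEquiv.ofRel (fun x y => (x.1 : ℤ) + j = y.1) (by intros; omega) (by intros; omega)

/-- The reversal `x ↦ n - 1 - x`. -/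
noncomputable def reversal (n : ℕ) : Fin n ≃. Fin n :=
  PEquiv.ofRel (fun x y => x.1 + y.1 + 1 = n) (by intros; omega) (by intros; omega)

/-- The rotation `x ↦ x + k` of the cycle. -/
noncomputable def cycleRotation (n k : ℕ) : Fin n ≃. Fin n :=
  PEquiv.ofRel (fun x y => x.1 + k = y.1 ∨ x.1 + k = y.1 + n)
    (by intros; omega) (by intros; omega)

/-- The map `0 ↦ 0`, `i ↦ n - i` with domain `{0, i}`, a restriction of a reflection. -/
noncomputable def cycleFlip (n i : ℕ) : Fin n ≃. Fin n :=
  PEquiv.ofRel (fun x y => x.1 = 0 ∧ y.1 = 0 ∨ x.1 = i ∧ y.1 + i = n)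
    (by intros; omega) (by intros; omega)

theorem partialId_eq_some_iff {V : Type*} {s : Set V} {x y : V} :
    partialId s x = some y ↔ x = y ∧ x ∈ s :=
  PEquiv.ofRel_eq_some_iff

theorem shift_eq_some_iff {n : ℕ} {j : ℤ} {x y : Fin n} :
    shift n j x = some y ↔ (x.1 : ℤ) + j = y.1 :=
  PEquiv.ofRel_eq_some_iff

theorem reversal_eq_some_iff {n : ℕ} {x y : Fin n} :
    reversal n x = some y ↔ x.1 + y.1 + 1 = n :=
  PEquiv.ofRel_eq_some_iff

theorem cycleRotation_eq_some_iff {n k : ℕ} {x y : Fin n} :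
    cycleRotation n k x = some y ↔ x.1 + k = y.1 ∨ x.1 + k = y.1 + n :=
  PEquiv.ofRel_eq_some_iff

theorem cycleFlip_eq_some_iff {n i : ℕ} {x y : Fin n} :
    cycleFlip n i x = some y ↔ x.1 = 0 ∧ y.1 = 0 ∨ x.1 = i ∧ y.1 + i = n :=
  PEquiv.ofRel_eq_some_iff

/-! ### Generation -/

theorem partialId_inter {V : Type*} (s t : Set V) :
    partialId (s ∩ t) = partialId s * partialId t := by
  refine PEquiv.ext_some fun x y => ?_
  rw [PEquiv.mul_eq_some_iff, partialId_eq_some_iff]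
  simp only [partialId_eq_some_iff]
  grind

theorem partialId_univ {V : Type*} : partialId (Set.univ : Set V) = 1 := by
  refine PEquiv.ext_some fun x y => ?_
  rw [PEquiv.one_eq_some_iff, partialId_eq_some_iff]
  simp

section Generation

variable {V : Type*} [Finite V] {N : Submonoid (V ≃. V)}

theorem partialId_mem (he : ∀ v, partialId {v}ᶜ ∈ N) (s : Set V) : partialId s ∈ N := by
  suffices h : ∀ t : Set V, t.Finite → partialId tᶜ ∈ N by
    have := h sᶜ (Set.toFinite _)
    rwa [compl_compl] at this
  intro t ht
  induction t, ht using Set.Finite.induction_on with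
  | empty => rw [Set.compl_empty, partialId_univ]; exact N.one_mem
  | @insert v t _ _ ih =>
    rw [Set.insert_eq, Set.compl_union, partialId_inter]
    exact N.mul_mem (he v) ih

/-- A restriction of `β` is the partial identity on its domain followed by `β`. Generation proofs
therefore only have to exhibit an extension. -/
theorem mem_of_le (he : ∀ v, partialId {v}ᶜ ∈ N) {α β : V ≃. V} (hβ : β ∈ N)
    (h : ∀ x y, α x = some y → β x = some y) : α ∈ N := by
  have e : α = partialId {x | ∃ y, α x = some y} * β := by
    refine PEquiv.ext_some fun x y => ?_
    rw [PEquiv.mul_eq_some_iff]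
    constructor
    · intro hx
      exact ⟨x, partialId_eq_some_iff.2 ⟨rfl, y, hx⟩, h x y hx⟩
    · rintro ⟨z, hz, hy⟩
      obtain ⟨rfl, w, hw⟩ := partialId_eq_some_iff.1 hz
      have := h _ _ hw
      rw [hy] at this
      rwa [this]
  rw [e]
  exact N.mul_mem (partialId_mem he _) hβ

end Generation

theorem shift_mem {n : ℕ} {N : Submonoid (Fin n ≃. Fin n)} (he : ∀ v, partialId {v}ᶜ ∈ N)
    (hs : shift n 1 ∈ N) (hs' : shift n (-1) ∈ N) (j : ℤ) : shift n j ∈ N := by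
  have h0 : shift n 0 ∈ N := mem_of_le he N.one_mem fun x y h => by
    rw [shift_eq_some_iff] at h
    rw [PEquiv.one_eq_some_iff]
    omega
  induction j using Int.induction_on with
  | zero => exact h0
  | succ i ih =>
    refine mem_of_le he (N.mul_mem ih hs) fun x y h => ?_
    rw [shift_eq_some_iff] at h
    rw [PEquiv.mul_eq_some_iff]
    have hy := y.2
    refine ⟨⟨x.1 + i, by omega⟩, ?_, ?_⟩ <;> rw [shift_eq_some_iff] <;> push_cast <;> omega
  | pred i ih =>
    refine mem_of_le he (N.mul_mem ih hs') fun x y h => ?_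
    rw [shift_eq_some_iff] at h
    rw [PEquiv.mul_eq_some_iff]
    have hx := x.2
    refine ⟨⟨x.1 - i, by omega⟩, ?_, ?_⟩ <;> rw [shift_eq_some_iff] <;>
      push_cast [show i ≤ x.1 by omega] <;> omega

theorem ODI_le_MDI (n : ℕ) : ODI n ≤ MDI n := fun _ h => ⟨h.1, Or.inl h.2⟩

/-- If some distance changes, the domain is that single pair and the map is a flip between two
translations; otherwise order and distances fix the displacement, and the map is a restriction of a
translation. -/
theorem ODI_le_of_mem {n : ℕ} (hn : 2 ≤ n) {N : Submonoid (Fin n ≃. Fin n)}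
    (he : ∀ v, partialId {v}ᶜ ∈ N) (hs : shift n 1 ∈ N) (hs' : shift n (-1) ∈ N)
    (hf : ∀ i, 1 ≤ i → i < n → 2 * i ≠ n → cycleFlip n i ∈ N) : ODI n ≤ N := by
  intro α hα
  have hd := (mem_DI_iff hn α).1 hα.1
  have ho := hα.2
  by_cases hflip : ∃ a b a' b', α a = some a' ∧ α b = some b' ∧ a < b ∧
      Nat.dist a' b' ≠ Nat.dist a b
  · obtain ⟨a, b, a', b', ha, hb, hab, hne⟩ := hflip
    have h1 := (hd _ _ _ _ ha hb).resolve_left hne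
    have h2 := ho _ _ _ _ ha hb hab.le
    have hb' := b'.2
    have hb2 := b.2
    rw [Fin.lt_def] at hab
    rw [Fin.le_def] at h2
    have hne' := hne
    unfold Nat.dist at h1 hne'
    -- Move `a` to `0`, flip the pair `{0, b - a}`, then move `0` to `a'`.
    refine mem_of_le he (N.mul_mem (N.mul_mem (shift_mem he hs hs' (-a.1))
      (hf (b.1 - a.1) (by omega) (by omega) (by omega))) (shift_mem he hs hs' a'.1)) ?_
    intro x y hx
    have hxab : x = a ∨ x = b := by
      by_contra! hc
      exact hne (dist_eq_of_monotone_of_three hn (ODI_le_MDI n hα) ha hb hx hc.1.symm hc.2.symm)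
    rw [PEquiv.mul_eq_some_iff]
    simp only [PEquiv.mul_eq_some_iff, shift_eq_some_iff, cycleFlip_eq_some_iff]
    rcases hxab with rfl | rfl
    · obtain rfl := (α.image_eq_iff ha hx).2 rfl
      exact ⟨⟨0, by omega⟩, ⟨⟨0, by omega⟩, by simp, by simp⟩, by simp⟩
    · obtain rfl := (α.image_eq_iff hb hx).2 rfl
      refine ⟨⟨n - (x.1 - a.1), by omega⟩, ⟨⟨x.1 - a.1, by omega⟩, ?_, Or.inr ⟨rfl, ?_⟩⟩, ?_⟩
      · push_cast [hab.le]; omega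
      · change n - (x.1 - a.1) + (x.1 - a.1) = n
        omega
      · change ((n - (x.1 - a.1) : ℕ) : ℤ) + a'.1 = b'.1
        omega
  · push Not at hflip
    by_cases hdom : ∃ a a', α a = some a'
    · obtain ⟨a, a', ha⟩ := hdom
      refine mem_of_le he (shift_mem he hs hs' ((a'.1 : ℤ) - a.1)) fun x y hx => ?_
      rw [shift_eq_some_iff]
      have h1 := hflip _ _ _ _ ha hx
      have h2 := hflip _ _ _ _ hx ha
      have h3 := ho _ _ _ _ ha hx
      have h4 := ho _ _ _ _ hx ha
      have h5 := α.image_eq_iff ha hx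
      rw [Fin.ext_iff, Fin.ext_iff] at h5
      rw [Fin.lt_def] at h1 h2
      rw [Fin.le_def, Fin.le_def] at h3 h4
      unfold Nat.dist at h1 h2
      omega
    · push Not at hdom
      exact mem_of_le he N.one_mem fun x y hx => absurd hx (hdom x y)

theorem cycleRotation_zero (n : ℕ) : cycleRotation n 0 = 1 := by
  refine PEquiv.ext_some fun x y => ?_
  rw [PEquiv.one_eq_some_iff, cycleRotation_eq_some_iff]
  omega

theorem cycleRotation_mem {n : ℕ} {N : Submonoid (Fin n ≃. Fin n)}
    (hr : cycleRotation n 1 ∈ N) (k : ℕ) (hk : k ≤ n) : cycleRotation n k ∈ N := by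
  induction k with
  | zero => rw [cycleRotation_zero]; exact N.one_mem
  | succ k ih =>
    have e : cycleRotation n (k + 1) = cycleRotation n k * cycleRotation n 1 := by
      refine PEquiv.ext_some fun x y => ?_
      rw [PEquiv.mul_eq_some_iff]
      simp only [cycleRotation_eq_some_iff]
      constructor
      · intro h
        by_cases hx : x.1 + k < n
        · exact ⟨⟨x.1 + k, hx⟩, Or.inl rfl, by dsimp only; omega⟩
        · exact ⟨⟨x.1 + k - n, by omega⟩, by dsimp only; omega, by dsimp only; omega⟩
      · rintro ⟨z, h1, h2⟩
        omega
    rw [e]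
    exact N.mul_mem (ih (by omega)) hr

/-- Rotations conjugate one idempotent into all the others, so a single one suffices. -/
theorem OPDI_le_of_mem {n : ℕ} (hn : 2 ≤ n) {N : Submonoid (Fin n ≃. Fin n)}
    (he0 : ∃ v, partialId {v}ᶜ ∈ N) (hr : cycleRotation n 1 ∈ N)
    (hf : ∀ i, 1 ≤ i → 2 * i < n → cycleFlip n i ∈ N) : OPDI n ≤ N := by
  have hrot := cycleRotation_mem hr
  have step : ∀ v w : Fin n, v.1 + 1 = w.1 ∨ v.1 + 1 = w.1 + n →
      partialId {v}ᶜ ∈ N → partialId {w}ᶜ ∈ N := by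
    intro v w hvw hv
    have e : partialId {w}ᶜ = cycleRotation n (n - 1) * partialId {v}ᶜ * cycleRotation n 1 := by
      refine PEquiv.ext_some fun x y => ?_
      rw [PEquiv.mul_eq_some_iff]
      simp only [PEquiv.mul_eq_some_iff, cycleRotation_eq_some_iff, partialId_eq_some_iff,
        Set.mem_compl_iff, Set.mem_singleton_iff, Fin.ext_iff]
      constructor
      · rintro ⟨h1, h2⟩
        by_cases hx : x.1 = 0
        · have : n - 1 < n := by omega
          refine ⟨⟨n - 1, this⟩, ⟨⟨n - 1, this⟩, ?_, rfl, ?_⟩, ?_⟩ <;> dsimp only <;> omega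
        · have : x.1 - 1 < n := by omega
          refine ⟨⟨x.1 - 1, this⟩, ⟨⟨x.1 - 1, this⟩, ?_, rfl, ?_⟩, ?_⟩ <;> dsimp only <;> omega
      · rintro ⟨z, ⟨u, h1, h2, h3⟩, h4⟩
        omega
    rw [e]
    exact N.mul_mem (N.mul_mem (hrot _ (by omega)) hv) hr
  have he : ∀ v, partialId {v}ᶜ ∈ N := by
    obtain ⟨v₀, hv₀⟩ := he0
    have walk : ∀ k, partialId {(⟨(v₀.1 + k) % n, Nat.mod_lt _ (by omega)⟩ : Fin n)}ᶜ ∈ N := by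
      intro k
      induction k with
      | zero => simpa only [Nat.add_zero, Nat.mod_eq_of_lt v₀.2] using hv₀
      | succ k ih =>
        refine step _ _ ?_ ih
        have h1 := Nat.mod_lt (v₀.1 + k) (show 0 < n by omega)
        have h2 : (v₀.1 + (k + 1)) % n = ((v₀.1 + k) % n + 1) % n := by
          rw [Nat.mod_add_mod, add_assoc]
        dsimp only
        rw [h2]
        by_cases h : (v₀.1 + k) % n + 1 < n
        · exact Or.inl (Nat.mod_eq_of_lt h).symm
        · have : (v₀.1 + k) % n + 1 = n := by omega
          rw [this, Nat.mod_self]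
          omega
    intro v
    have hv := v.2
    -- This many steps lead from `v₀` once past the end of the chain and on to `v`.
    have := walk (n - v₀.1 + v.1)
    rwa [show (⟨(v₀.1 + (n - v₀.1 + v.1)) % n, Nat.mod_lt _ (by omega)⟩ : Fin n) = v from
      Fin.ext (by
        change (v₀.1 + (n - v₀.1 + v.1)) % n = v.1
        rw [show v₀.1 + (n - v₀.1 + v.1) = v.1 + n by omega, Nat.add_mod_right,
          Nat.mod_eq_of_lt hv])] at this
  intro α hα
  have hd := (mem_DI_iff hn α).1 hα.1
  by_cases hflip : ∃ a b a' b', α a = some a' ∧ α b = some b' ∧ ¬ RotationPair a b a' b'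
  -- After a swap, the arc from `a` forward to `b` is shorter than half the cycle. Antipodal pairs
  -- cannot occur, because an isometry always acts on them as a rotation.
  · obtain ⟨a, b, a', b', ha, hb, hnr, hgap⟩ : ∃ a b a' b', α a = some a' ∧ α b = some b' ∧
        ¬ RotationPair a b a' b' ∧
        (a.1 < b.1 ∧ 2 * (b.1 - a.1) < n ∨ b.1 < a.1 ∧ 2 * (b.1 + n - a.1) < n) := by
      obtain ⟨a, b, a', b', ha, hb, hnr⟩ := hflip
      have h1 := hd _ _ _ _ ha hb
      have h2 := α.image_eq_iff ha hb
      rw [Fin.ext_iff, Fin.ext_iff] at h2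
      by_cases h : a.1 < b.1 ∧ 2 * (b.1 - a.1) < n ∨ b.1 < a.1 ∧ 2 * (b.1 + n - a.1) < n
      · exact ⟨a, b, a', b', ha, hb, hnr, h⟩
      · refine ⟨b, a, b', a', hb, ha, fun h => hnr h.swap, ?_⟩
        unfold RotationPair at hnr
        unfold Nat.dist at h1
        omega
    have h1 := hd _ _ _ _ ha hb
    have ha2 := a.2
    have hb2 := b.2
    have ha2' := a'.2
    have hb2' := b'.2
    obtain ⟨i, hi, hin, hab⟩ : ∃ i, 1 ≤ i ∧ 2 * i < n ∧ (a.1 + i = b.1 ∨ a.1 + i = b.1 + n) := by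
      rcases hgap with h | h
      · exact ⟨b.1 - a.1, by omega, by omega, by omega⟩
      · exact ⟨b.1 + n - a.1, by omega, by omega, by omega⟩
    -- Not being a rotation, the map sends `b` to the point `i` steps behind `a'` instead of ahead
    -- of it.
    have hab' : b'.1 + i = a'.1 ∨ b'.1 + i = a'.1 + n := by
      unfold RotationPair at hnr
      unfold Nat.dist at h1
      omega
    refine mem_of_le he (N.mul_mem (N.mul_mem (hrot (n - a.1) (by omega))
      (hf i hi hin)) (hrot a'.1 (by omega))) ?_
    intro x y hx
    have hxab : x = a ∨ x = b := by
      by_contra! hc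
      exact hnr (rotationPair_of_three hn hα ha hb hx hc.1.symm hc.2.symm)
    rw [PEquiv.mul_eq_some_iff]
    simp only [PEquiv.mul_eq_some_iff, cycleRotation_eq_some_iff, cycleFlip_eq_some_iff]
    rcases hxab with rfl | rfl
    · obtain rfl := (α.image_eq_iff ha hx).2 rfl
      refine ⟨⟨0, by omega⟩, ⟨⟨0, by omega⟩, ?_, by simp⟩, by simp⟩
      dsimp only
      omega
    · obtain rfl := (α.image_eq_iff hb hx).2 rfl
      refine ⟨⟨n - i, by omega⟩, ⟨⟨i, by omega⟩, ?_, Or.inr ⟨rfl, ?_⟩⟩, ?_⟩ <;> dsimp only <;> omega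
  · push Not at hflip
    by_cases hdom : ∃ a a', α a = some a'
    · obtain ⟨a, a', ha⟩ := hdom
      have ha2 := a.2
      have ha2' := a'.2
      obtain ⟨k, hk, hak⟩ : ∃ k ≤ n, a.1 + k = a'.1 ∨ a.1 + k = a'.1 + n := by
        by_cases h : a.1 ≤ a'.1
        · exact ⟨a'.1 - a.1, by omega, by omega⟩
        · exact ⟨a'.1 + n - a.1, by omega, by omega⟩
      refine mem_of_le he (hrot k hk) fun x y hx => ?_
      rw [cycleRotation_eq_some_iff]
      have h1 := hflip _ _ _ _ ha hx
      unfold RotationPair at h1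
      omega
    · push Not at hdom
      exact mem_of_le he N.one_mem fun x y hx => absurd hx (hdom x y)

/-! ### Membership of the generators -/

theorem partialId_mem_ODI {n : ℕ} (hn : 2 ≤ n) (s : Set (Fin n)) : partialId s ∈ ODI n := by
  refine ⟨(mem_DI_iff hn _).2 fun x y x' y' hx hy => ?_, fun x y x' y' hx hy h => ?_⟩ <;>
    rw [partialId_eq_some_iff] at hx hy <;> obtain ⟨rfl, -⟩ := hx <;> obtain ⟨rfl, -⟩ := hy
  · exact Or.inl rfl
  · exact h

theorem partialId_mem_OPDI {n : ℕ} (hn : 2 ≤ n) (s : Set (Fin n)) : partialId s ∈ OPDI n := by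
  refine ⟨(partialId_mem_ODI hn s).1, (orientationPreserving_iff _).2 ?_⟩
  intro x y z x' y' z' hx hy hz h
  rw [partialId_eq_some_iff] at hx hy hz
  rwa [← hx.1, ← hy.1, ← hz.1]

theorem shift_mem_ODI {n : ℕ} (hn : 2 ≤ n) (j : ℤ) : shift n j ∈ ODI n := by
  refine ⟨(mem_DI_iff hn _).2 fun x y x' y' hx hy => ?_, fun x y x' y' hx hy h => ?_⟩ <;>
    rw [shift_eq_some_iff] at hx hy
  · unfold Nat.dist
    omega
  · rw [Fin.le_def] at *
    omega

theorem cycleFlip_mem_ODI {n : ℕ} (hn : 2 ≤ n) (i : ℕ) : cycleFlip n i ∈ ODI n := by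
  refine ⟨(mem_DI_iff hn _).2 fun x y x' y' hx hy => ?_, fun x y x' y' hx hy h => ?_⟩ <;>
    rw [cycleFlip_eq_some_iff] at hx hy
  · unfold Nat.dist
    omega
  · rw [Fin.le_def] at *
    omega

/-- A domain of at most two points contains no cyclic triple, so the orientation condition is
vacuous. -/
theorem cycleFlip_mem_OPDI {n : ℕ} (hn : 2 ≤ n) (i : ℕ) : cycleFlip n i ∈ OPDI n := by
  refine ⟨(cycleFlip_mem_ODI hn i).1, (orientationPreserving_iff _).2 ?_⟩
  intro x y z x' y' z' hx hy hz h
  rw [cycleFlip_eq_some_iff] at hx hy hz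
  simp only [CycTriple, Fin.lt_def] at h
  omega

theorem reversal_mem_MDI {n : ℕ} (hn : 2 ≤ n) : reversal n ∈ MDI n := by
  refine ⟨(mem_DI_iff hn _).2 fun x y x' y' hx hy => ?_, Or.inr fun x y x' y' hx hy h => ?_⟩ <;>
    rw [reversal_eq_some_iff] at hx hy
  · unfold Nat.dist
    omega
  · rw [Fin.le_def] at *
    omega

theorem cycleRotation_mem_OPDI {n : ℕ} (hn : 2 ≤ n) (k : ℕ) : cycleRotation n k ∈ OPDI n := by
  refine ⟨(mem_DI_iff hn _).2 fun x y x' y' hx hy => ?_, (orientationPreserving_iff _).2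
    fun x y z x' y' z' hx hy hz h => ?_⟩
  · rw [cycleRotation_eq_some_iff] at hx hy
    unfold Nat.dist
    omega
  · rw [cycleRotation_eq_some_iff] at hx hy hz
    simp only [CycTriple, Fin.lt_def] at *
    omega

/-! ### Unavoidable sets: total maps and maps omitting one point -/

section Domains

variable {V : Type*}

/-- The nontrivial partial permutations with full domain. -/
def totalNonOne (V : Type*) : Set (V ≃. V) := {α | (∀ x, ∃ y, α x = some y) ∧ α ≠ 1}

/-- The partial permutations whose domain misses exactly one point, which lies in `K`. -/
def missingOne {V : Type*} (K : Set V) : Set (V ≃. V) :=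
  {α | ∃ k ∈ K, ∀ x, (∃ y, α x = some y) ↔ x ≠ k}

theorem PEquiv.exists_preimage_of_total [Finite V] {α : V ≃. V} (h : ∀ x, ∃ y, α x = some y) (y : V) :
    ∃ x, α x = some y := by
  choose f hf using h
  have hinj : Function.Injective f := fun a b hab => α.inj (hf a) (hab ▸ hf b)
  obtain ⟨x, rfl⟩ := Finite.surjective_of_injective hinj y
  exact ⟨x, hf x⟩

theorem PEquiv.total_of_mul_total [Finite V] {α β : V ≃. V} (h : ∀ x, ∃ y, (α * β) x = some y) :
    (∀ x, ∃ y, α x = some y) ∧ ∀ x, ∃ y, β x = some y := by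
  simp only [PEquiv.mul_eq_some_iff] at h
  have hα : ∀ x, ∃ y, α x = some y := fun x => by
    obtain ⟨_, y, hy, -⟩ := h x
    exact ⟨y, hy⟩
  refine ⟨hα, fun y => ?_⟩
  obtain ⟨x, hx⟩ := PEquiv.exists_preimage_of_total hα y
  obtain ⟨z, w, hw, hz⟩ := h x
  obtain rfl := Option.some.inj (hw.symm.trans hx)
  exact ⟨z, hz⟩

theorem one_notMem_totalNonOne : (1 : V ≃. V) ∉ totalNonOne V := fun h => h.2 rfl

theorem totalNonOne_of_mul [Finite V] {α β : V ≃. V} (h : α * β ∈ totalNonOne V) :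
    α ∈ totalNonOne V ∨ β ∈ totalNonOne V := by
  obtain ⟨hα, hβ⟩ := PEquiv.total_of_mul_total h.1
  by_cases e : α = 1
  · by_cases e' : β = 1
    · exact absurd (by rw [e, e', one_mul]) h.2
    · exact Or.inr ⟨hβ, e'⟩
  · exact Or.inl ⟨hα, e⟩

theorem notMem_missingOne_of_total {α : V ≃. V} (h : ∀ x, ∃ y, α x = some y) (K : Set V) :
    α ∉ missingOne K := fun ⟨k, _, hk⟩ => (hk k).1 (h k) rfl

theorem one_notMem_missingOne (K : Set V) : (1 : V ≃. V) ∉ missingOne K :=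
  notMem_missingOne_of_total (fun x => ⟨x, rfl⟩) K

/-- Either `α` already omits `k`, or `α` is a permutation and `β` omits exactly the image of `k`,
which `hK` keeps in `K`. -/
theorem missingOne_of_mul [Finite V] {α β : V ≃. V} {K : Set V}
    (hK : (∀ x, ∃ y, α x = some y) → ∀ x y, α x = some y → x ∈ K → y ∈ K)
    (h : α * β ∈ missingOne K) : α ∈ missingOne K ∨ β ∈ missingOne K := by
  obtain ⟨k, hk, hdom⟩ := h
  simp only [PEquiv.mul_eq_some_iff] at hdom
  have hα : ∀ x, x ≠ k → ∃ y, α x = some y := fun x hx => by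
    obtain ⟨_, y, hy, -⟩ := (hdom x).2 hx
    exact ⟨y, hy⟩
  by_cases hαk : ∃ y, α k = some y
  · have total : ∀ x, ∃ y, α x = some y := fun x => by
      by_cases hx : x = k
      · rwa [hx]
      · exact hα x hx
    obtain ⟨k', hk'⟩ := hαk
    refine Or.inr ⟨k', hK total k k' hk' hk, fun y => ?_⟩
    obtain ⟨x, hx⟩ := PEquiv.exists_preimage_of_total total y
    rw [Ne, α.image_eq_iff hx hk', ← Ne, ← hdom x]
    constructor
    · rintro ⟨z, hz⟩
      exact ⟨z, y, hx, hz⟩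
    · rintro ⟨z, w, hw, hz⟩
      obtain rfl := Option.some.inj (hw.symm.trans hx)
      exact ⟨z, hz⟩
  · refine Or.inl ⟨k, hk, fun x => ⟨?_, hα x⟩⟩
    rintro hx rfl
    exact hαk hx

theorem exists_mem_of_missingOne {α : V ≃. V} {K L : Set V} (hK : α ∈ missingOne K)
    (hL : α ∈ missingOne L) : ∃ k, k ∈ K ∧ k ∈ L := by
  obtain ⟨k, hk, h⟩ := hK
  obtain ⟨l, hl, h'⟩ := hL
  have : k = l := by
    by_contra hkl
    exact (h k).1 ((h' k).2 hkl) rfl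
  exact ⟨k, hk, this ▸ hl⟩

theorem partialId_mem_missingOne {K : Set V} {k : V} (hk : k ∈ K) :
    partialId {k}ᶜ ∈ missingOne K :=
  ⟨k, hk, fun x => by simp [partialId_eq_some_iff]⟩

end Domains

theorem shift_neg_one_mem_missingOne {n : ℕ} {K : Set (Fin n)} {k : Fin n} (hk : k ∈ K)
    (h : k.1 = 0) : shift n (-1) ∈ missingOne K := by
  refine ⟨k, hk, fun x => ?_⟩
  simp only [shift_eq_some_iff, Ne, Fin.ext_iff]
  constructor
  · rintro ⟨y, hy⟩
    omega
  · intro hx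
    exact ⟨⟨x.1 - 1, by omega⟩, by dsimp only; omega⟩

theorem shift_one_mem_missingOne {n : ℕ} {K : Set (Fin n)} {k : Fin n} (hk : k ∈ K)
    (h : k.1 + 1 = n) : shift n 1 ∈ missingOne K := by
  refine ⟨k, hk, fun x => ?_⟩
  simp only [shift_eq_some_iff, Ne, Fin.ext_iff]
  constructor
  · rintro ⟨y, hy⟩
    omega
  · intro hx
    exact ⟨⟨x.1 + 1, by omega⟩, by dsimp only; omega⟩

/-- The domain has a point outside any given pair. -/
def HasThirdPoint {V : Type*} (α : V ≃. V) : Prop :=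
  ∀ a b, ∃ c c', α c = some c' ∧ a ≠ c ∧ b ≠ c

/-- The points `a`, `b`, `k` cannot exhaust a set of at least four. -/
theorem hasThirdPoint_of_forall_ne {n : ℕ} (hn : 4 ≤ n) {α : Fin n ≃. Fin n} (k : Fin n)
    (h : ∀ x, x ≠ k → ∃ y, α x = some y) : HasThirdPoint α := by
  intro a b
  obtain ⟨c, -, hc⟩ := Finset.exists_mem_notMem_of_card_lt_card
    (s := {a, b, k}) (t := (Finset.univ : Finset (Fin n))) (by
      have := Finset.card_le_three (a := a) (b := b) (c := k)
      rw [Finset.card_univ, Fintype.card_fin]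
      omega)
  simp only [Finset.mem_insert, Finset.mem_singleton, not_or] at hc
  obtain ⟨c', hc'⟩ := h c hc.2.2
  exact ⟨c, c', hc', Ne.symm hc.1, Ne.symm hc.2.1⟩

theorem hasThirdPoint_of_total {n : ℕ} (hn : 4 ≤ n) {α : Fin n ≃. Fin n}
    (h : ∀ x, ∃ y, α x = some y) : HasThirdPoint α :=
  hasThirdPoint_of_forall_ne hn ⟨0, by omega⟩ fun x _ => h x

theorem hasThirdPoint_of_missingOne {n : ℕ} (hn : 4 ≤ n) {α : Fin n ≃. Fin n} {K : Set (Fin n)}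
    (h : α ∈ missingOne K) : HasThirdPoint α := by
  obtain ⟨k, -, hk⟩ := h
  exact hasThirdPoint_of_forall_ne hn k fun x hx => (hk x).2 hx

/-- All linear distances are kept, so the two endpoints, at distance `n - 1`, go to endpoints; every
other image is determined by its distance from the image of `0`. -/
theorem eq_or_reverse_of_total {n : ℕ} (hn : 4 ≤ n) {α : Fin n ≃. Fin n} (hα : α ∈ MDI n)
    (h : ∀ x, ∃ y, α x = some y) :
    (∀ x y, α x = some y → x = y) ∨
      ∀ x y, α x = some y → x.1 + y.1 + 1 = n := by
  have hd : ∀ x y x' y', α x = some x' → α y = some y' → Nat.dist x' y' = Nat.dist x y := by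
    intro x y x' y' hx hy
    obtain ⟨c, c', hc, h1, h2⟩ := hasThirdPoint_of_total hn h x y
    exact dist_eq_of_monotone_of_three (by omega) hα hx hy hc h1 h2
  let z : Fin n := ⟨0, by omega⟩
  let l : Fin n := ⟨n - 1, by omega⟩
  have hz : z.1 = 0 := rfl
  have hl : l.1 = n - 1 := rfl
  obtain ⟨z', hz'⟩ := h z
  obtain ⟨l', hl'⟩ := h l
  have h1 := hd _ _ _ _ hz' hl'
  have := z'.2
  have := l'.2
  have hzl : z ≤ l := by rw [Fin.le_def]; omega
  rcases hα.2 with ho | ho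
  · left
    intro x y hx
    have h2 := ho _ _ _ _ hz' hl' hzl
    have h3 := hd _ _ _ _ hz' hx
    rw [Fin.le_def] at h2
    rw [Fin.ext_iff]
    unfold Nat.dist at h1 h3
    omega
  · right
    intro x y hx
    have h2 := ho _ _ _ _ hz' hl' hzl
    have h3 := hd _ _ _ _ hz' hx
    rw [Fin.le_def] at h2
    unfold Nat.dist at h1 h3
    omega

/-! ### Unavoidable sets: flips of a distance -/

/-- The partial permutations that change some distance `i` to `n - i`. -/
def flipping (n i : ℕ) : Set (Fin n ≃. Fin n) :=
  {α | ∃ a b a' b', α a = some a' ∧ α b = some b' ∧ Nat.dist a b = i ∧ Nat.dist a' b' + i = n}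

theorem one_notMem_flipping {n i : ℕ} (hi : 2 * i ≠ n) : (1 : Fin n ≃. Fin n) ∉ flipping n i := by
  rintro ⟨a, b, a', b', ha, hb, h1, h2⟩
  rw [PEquiv.one_eq_some_iff] at ha hb
  subst ha hb
  omega

/-- The intermediate pair has distance `i` or `n - i`: in the first case `β` flips, in the second
`α` does. -/
theorem flipping_of_mul {n i : ℕ} (hn : 2 ≤ n) {α β : Fin n ≃. Fin n} (hα : α ∈ DI n)
    (h : α * β ∈ flipping n i) : α ∈ flipping n i ∨ β ∈ flipping n i := by
  obtain ⟨a, b, a', b', ha, hb, h1, h2⟩ := h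
  rw [PEquiv.mul_eq_some_iff] at ha hb
  obtain ⟨u, hu, ha⟩ := ha
  obtain ⟨v, hv, hb⟩ := hb
  rcases (mem_DI_iff hn α).1 hα _ _ _ _ hu hv with h | h
  · exact Or.inr ⟨u, v, a', b', ha, hb, by omega, h2⟩
  · exact Or.inl ⟨a, b, u, v, hu, hv, h1, by omega⟩

theorem not_hasThirdPoint_of_flipping {n i : ℕ} (hn : 2 ≤ n) (hi : 2 * i ≠ n)
    {α : Fin n ≃. Fin n} (hα : α ∈ MDI n) (h : α ∈ flipping n i) : ¬ HasThirdPoint α := by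
  intro h3
  obtain ⟨a, b, a', b', ha, hb, h1, h2⟩ := h
  obtain ⟨c, c', hc, hac, hbc⟩ := h3 a b
  have := dist_eq_of_monotone_of_three hn hα ha hb hc hac hbc
  omega

/-- By rigidity each flipped pair is the whole domain, so the two pairs coincide. -/
theorem flipping_disjoint {n i j : ℕ} (hn : 2 ≤ n) (hi : 2 * i ≠ n) (hj : 2 * j ≠ n)
    {α : Fin n ≃. Fin n} (hα : α ∈ MDI n) (h : α ∈ flipping n i) (h' : α ∈ flipping n j) :
    i = j := by
  obtain ⟨a, b, a', b', ha, hb, h1, h2⟩ := h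
  obtain ⟨c, d, c', d', hc, hd, h3, h4⟩ := h'
  have hc' : a = c ∨ b = c := by
    by_contra! hne
    have := dist_eq_of_monotone_of_three hn hα ha hb hc hne.1 hne.2
    omega
  have hd' : a = d ∨ b = d := by
    by_contra! hne
    have := dist_eq_of_monotone_of_three hn hα ha hb hd hne.1 hne.2
    omega
  have hcd : c ≠ d := by
    rintro rfl
    obtain rfl := (α.image_eq_iff hc hd).2 rfl
    rw [Nat.dist_self] at h3 h4
    have := c'.2
    omega
  rcases hc' with rfl | rfl <;> rcases hd' with rfl | rfl
  · exact absurd rfl hcd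
  · omega
  · rw [Nat.dist_comm] at h3
    omega
  · exact absurd rfl hcd

theorem cycleFlip_mem_flipping {n i : ℕ} (hi : 1 ≤ i) (hin : i < n) :
    cycleFlip n i ∈ flipping n i := by
  refine ⟨⟨0, by omega⟩, ⟨i, hin⟩, ⟨0, by omega⟩, ⟨n - i, by omega⟩, ?_, ?_, ?_, ?_⟩
  · rw [cycleFlip_eq_some_iff]
    exact Or.inl ⟨rfl, rfl⟩
  · rw [cycleFlip_eq_some_iff]
    exact Or.inr ⟨rfl, Nat.sub_add_cancel hin.le⟩
  · simp [Nat.dist]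
  · simp only [Nat.dist]
    omega

/-- The partial permutations that act on some pair at cycle distance `i` not as a rotation. -/
def nonRotating (n i : ℕ) : Set (Fin n ≃. Fin n) :=
  {α | ∃ a b a' b', α a = some a' ∧ α b = some b' ∧
    (Nat.dist a b = i ∨ Nat.dist a b + i = n) ∧ ¬ RotationPair a b a' b'}

theorem one_notMem_nonRotating {n i : ℕ} : (1 : Fin n ≃. Fin n) ∉ nonRotating n i := by
  rintro ⟨a, b, a', b', ha, hb, -, h⟩
  rw [PEquiv.one_eq_some_iff] at ha hb
  subst ha hb
  exact h (Or.inl (add_comm _ _ |>.trans (add_comm _ _)))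

theorem RotationPair.trans {n : ℕ} {a b u v x y : Fin n} (h : RotationPair a b u v)
    (h' : RotationPair u v x y) : RotationPair a b x y := by
  unfold RotationPair at *
  omega

/-- Rotations compose, so one factor fails to rotate; `α` keeps the cycle distance of the pair. -/
theorem nonRotating_of_mul {n i : ℕ} (hn : 2 ≤ n) {α β : Fin n ≃. Fin n} (hα : α ∈ DI n)
    (h : α * β ∈ nonRotating n i) : α ∈ nonRotating n i ∨ β ∈ nonRotating n i := by
  obtain ⟨a, b, a', b', ha, hb, h1, h2⟩ := h
  rw [PEquiv.mul_eq_some_iff] at ha hb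
  obtain ⟨u, hu, ha⟩ := ha
  obtain ⟨v, hv, hb⟩ := hb
  have hd := (mem_DI_iff hn α).1 hα _ _ _ _ hu hv
  by_cases h : RotationPair a b u v
  · exact Or.inr ⟨u, v, a', b', ha, hb, by omega, fun h' => h2 (h.trans h')⟩
  · exact Or.inl ⟨a, b, u, v, hu, hv, h1, h⟩

theorem not_hasThirdPoint_of_nonRotating {n i : ℕ} (hn : 2 ≤ n) {α : Fin n ≃. Fin n}
    (hα : α ∈ OPDI n) (h : α ∈ nonRotating n i) : ¬ HasThirdPoint α := by
  intro h3
  obtain ⟨a, b, a', b', ha, hb, h1, h2⟩ := h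
  obtain ⟨c, c', hc, hac, hbc⟩ := h3 a b
  exact h2 (rotationPair_of_three hn hα ha hb hc hac hbc)

/-- Again both pairs are the whole domain; `2 * i < n` and `2 * j < n` select one of the two arcs.
-/
theorem nonRotating_disjoint {n i j : ℕ} (hn : 2 ≤ n) (hi : 2 * i < n) (hj : 2 * j < n)
    {α : Fin n ≃. Fin n} (hα : α ∈ OPDI n) (h : α ∈ nonRotating n i)
    (h' : α ∈ nonRotating n j) : i = j := by
  obtain ⟨a, b, a', b', ha, hb, h1, h2⟩ := h
  obtain ⟨c, d, c', d', hc, hd, h3, h4⟩ := h'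
  have hc' : a = c ∨ b = c := by
    by_contra! hne
    exact h2 (rotationPair_of_three hn hα ha hb hc hne.1 hne.2)
  have hd' : a = d ∨ b = d := by
    by_contra! hne
    exact h2 (rotationPair_of_three hn hα ha hb hd hne.1 hne.2)
  have hcd : c ≠ d := by
    rintro rfl
    obtain rfl := (α.image_eq_iff hc hd).2 rfl
    exact h4 (Or.inl (add_comm _ _))
  rcases hc' with rfl | rfl <;> rcases hd' with rfl | rfl
  · exact absurd rfl hcd
  · omega
  · rw [Nat.dist_comm] at h3
    omega
  · exact absurd rfl hcd

theorem cycleFlip_mem_nonRotating {n i : ℕ} (hi : 1 ≤ i) (hin : 2 * i < n) :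
    cycleFlip n i ∈ nonRotating n i := by
  refine ⟨⟨0, by omega⟩, ⟨i, by omega⟩, ⟨0, by omega⟩, ⟨n - i, by omega⟩, ?_, ?_, ?_, ?_⟩
  · rw [cycleFlip_eq_some_iff]
    exact Or.inl ⟨rfl, rfl⟩
  · rw [cycleFlip_eq_some_iff]
    exact Or.inr ⟨rfl, Nat.sub_add_cancel (by omega)⟩
  · simp [Nat.dist]
  · simp only [RotationPair]
    omega

/-! ### Indexing of flips and relations between generators -/

/-- The distances `i < n` with `i ≠ n - i`. -/
def flipIndex (n : ℕ) : Fin ((n - 1) / 2) ⊕ Fin ((n - 1) / 2) → ℕ :=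
  Sum.elim (fun j => j.1 + 1) (fun j => n - (j.1 + 1))

theorem flipIndex_spec {n : ℕ} (k : Fin ((n - 1) / 2) ⊕ Fin ((n - 1) / 2)) :
    1 ≤ flipIndex n k ∧ flipIndex n k < n ∧ 2 * flipIndex n k ≠ n := by
  rcases k with ⟨j, hj⟩ | ⟨j, hj⟩ <;> simp only [flipIndex, Sum.elim_inl, Sum.elim_inr] <;> omega

theorem flipIndex_injective (n : ℕ) : Function.Injective (flipIndex n) := by
  rintro (⟨i, hi⟩ | ⟨i, hi⟩) (⟨j, hj⟩ | ⟨j, hj⟩) h <;>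
    simp only [flipIndex, Sum.elim_inl, Sum.elim_inr] at h
  · obtain rfl : i = j := by omega
    rfl
  · omega
  · omega
  · obtain rfl : i = j := by omega
    rfl

theorem exists_flipIndex {n i : ℕ} (hi : 1 ≤ i) (hin : i < n) (h : 2 * i ≠ n) :
    ∃ k, flipIndex n k = i := by
  by_cases h' : i ≤ (n - 1) / 2
  · exact ⟨Sum.inl ⟨i - 1, by omega⟩, by simp only [flipIndex, Sum.elim_inl]; omega⟩
  · exact ⟨Sum.inr ⟨n - i - 1, by omega⟩, by simp only [flipIndex, Sum.elim_inr]; omega⟩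

/-- Through this product and the opposite one, the two shifts replace the idempotents omitting an
endpoint, at no cost in the number of generators. -/
theorem shift_neg_one_mul_shift_one {n : ℕ} {v : Fin n} (hv : v.1 = 0) :
    shift n (-1) * shift n 1 = partialId {v}ᶜ := by
  refine PEquiv.ext_some fun x y => ?_
  rw [PEquiv.mul_eq_some_iff, partialId_eq_some_iff]
  simp only [shift_eq_some_iff, Set.mem_compl_iff, Set.mem_singleton_iff, Fin.ext_iff]
  constructor
  · rintro ⟨z, h1, h2⟩
    omega
  · rintro ⟨h1, h2⟩
    refine ⟨⟨x.1 - 1, by omega⟩, ?_, ?_⟩ <;> dsimp only <;> omega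

theorem shift_one_mul_shift_neg_one {n : ℕ} {v : Fin n} (hv : v.1 + 1 = n) :
    shift n 1 * shift n (-1) = partialId {v}ᶜ := by
  refine PEquiv.ext_some fun x y => ?_
  rw [PEquiv.mul_eq_some_iff, partialId_eq_some_iff]
  simp only [shift_eq_some_iff, Set.mem_compl_iff, Set.mem_singleton_iff, Fin.ext_iff]
  constructor
  · rintro ⟨z, h1, h2⟩
    omega
  · rintro ⟨h1, h2⟩
    refine ⟨⟨x.1 + 1, by omega⟩, ?_, ?_⟩ <;> dsimp only <;> omega

theorem reversal_mul_reversal (n : ℕ) : reversal n * reversal n = 1 := by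
  refine PEquiv.ext_some fun x y => ?_
  rw [PEquiv.mul_eq_some_iff, PEquiv.one_eq_some_iff]
  simp only [reversal_eq_some_iff, Fin.ext_iff]
  constructor
  · rintro ⟨z, h1, h2⟩
    omega
  · intro h
    refine ⟨⟨n - 1 - x.1, by omega⟩, ?_, ?_⟩ <;> dsimp only <;> omega

theorem reversal_conj_shift_one (n : ℕ) :
    reversal n * shift n 1 * reversal n = shift n (-1) := by
  refine PEquiv.ext_some fun x y => ?_
  rw [PEquiv.mul_eq_some_iff]
  simp only [PEquiv.mul_eq_some_iff, reversal_eq_some_iff, shift_eq_some_iff]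
  constructor
  · rintro ⟨z, ⟨u, h1, h2⟩, h3⟩
    omega
  · intro h
    refine ⟨⟨n - 1 - y.1, by omega⟩, ⟨⟨n - 1 - x.1, by omega⟩, ?_, ?_⟩, ?_⟩ <;> dsimp only <;> omega

theorem reversal_conj_partialId {n : ℕ} {v w : Fin n} (h : v.1 + w.1 + 1 = n) :
    reversal n * partialId {v}ᶜ * reversal n = partialId {w}ᶜ := by
  refine PEquiv.ext_some fun x y => ?_
  rw [PEquiv.mul_eq_some_iff]
  simp only [PEquiv.mul_eq_some_iff, reversal_eq_some_iff, partialId_eq_some_iff,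
    Set.mem_compl_iff, Set.mem_singleton_iff, Fin.ext_iff]
  constructor
  · rintro ⟨z, ⟨u, h1, h2, h3⟩, h4⟩
    omega
  · rintro ⟨h1, h2⟩
    refine ⟨⟨n - 1 - y.1, by omega⟩, ⟨⟨n - 1 - x.1, by omega⟩, ?_, ?_, ?_⟩, ?_⟩ <;>
      dsimp only <;> omega

theorem mul_reversal_mem_ODI {n : ℕ} (hn : 2 ≤ n) {α : Fin n ≃. Fin n} (hα : α ∈ DI n)
    (h : OrderReversing α) : α * reversal n ∈ ODI n := by
  refine ⟨(DI n).mul_mem hα (reversal_mem_MDI hn).1, fun x y x' y' hx hy hxy => ?_⟩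
  rw [PEquiv.mul_eq_some_iff] at hx hy
  obtain ⟨u, hu, hx⟩ := hx
  obtain ⟨v, hv, hy⟩ := hy
  have := h x y u v hu hv hxy
  rw [reversal_eq_some_iff] at hx hy
  rw [Fin.le_def] at *
  omega

/-! ### The three ranks -/

theorem hasMonoidRank_ODI {n : ℕ} (hn : 4 ≤ n) :
    HasMonoidRank (ODI n) (n + 2 * ((n - 1) / 2)) := by
  classical
  let ι := Fin n ⊕ (Fin ((n - 1) / 2) ⊕ Fin ((n - 1) / 2))
  let gen : ι → (Fin n ≃. Fin n) := Sum.elim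
    (fun k => if k.1 = 0 then shift n (-1) else if k.1 + 1 = n then shift n 1 else partialId {k}ᶜ)
    (fun k => cycleFlip n (flipIndex n k))
  let A : ι → Set (Fin n ≃. Fin n) := Sum.elim (fun k => missingOne {k})
    (fun k => flipping n (flipIndex n k))
  have hcard : Fintype.card ι = n + 2 * ((n - 1) / 2) := by
    simp only [ι, Fintype.card_sum, Fintype.card_fin]
    omega
  rw [← hcard]
  have hgen : ∀ i, gen i ∈ Submonoid.closure (Set.range gen) := fun i =>
    Submonoid.subset_closure ⟨i, rfl⟩
  refine hasMonoidRank_of_family (ODI n) gen A (le_antisymm ?_ ?_) ?_ ?_ ?_ ?_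
  · rw [Submonoid.closure_le]
    rintro _ ⟨k | k, rfl⟩ <;> simp only [gen, Sum.elim_inl, Sum.elim_inr]
    · split_ifs
      exacts [shift_mem_ODI (by omega) _, shift_mem_ODI (by omega) _,
        partialId_mem_ODI (by omega) _]
    · exact cycleFlip_mem_ODI (by omega) _
  · have hs' : shift n (-1) ∈ Submonoid.closure (Set.range gen) := by
      simpa [gen] using hgen (Sum.inl ⟨0, by omega⟩)
    have hs : shift n 1 ∈ Submonoid.closure (Set.range gen) := by
      simpa [gen, show n - 1 ≠ 0 by omega, show n - 1 + 1 = n by omega] using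
        hgen (Sum.inl ⟨n - 1, by omega⟩)
    refine ODI_le_of_mem (by omega) (fun v => ?_) hs hs' fun i hi hin hne => ?_
    · by_cases h0 : v.1 = 0
      · rw [← shift_neg_one_mul_shift_one h0]
        exact Submonoid.mul_mem _ hs' hs
      by_cases h1 : v.1 + 1 = n
      · rw [← shift_one_mul_shift_neg_one h1]
        exact Submonoid.mul_mem _ hs hs'
      · simpa [gen, h0, h1] using hgen (Sum.inl v)
    · obtain ⟨k, rfl⟩ := exists_flipIndex hi hin hne
      exact hgen (Sum.inr k)
  · rintro (k | k) <;> simp only [gen, A, Sum.elim_inl, Sum.elim_inr]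
    · split_ifs with h0 h1
      exacts [shift_neg_one_mem_missingOne rfl h0, shift_one_mem_missingOne rfl h1,
        partialId_mem_missingOne rfl]
    · exact cycleFlip_mem_flipping (flipIndex_spec k).1 (flipIndex_spec k).2.1
  · rintro (k | k)
    · exact one_notMem_missingOne _
    · exact one_notMem_flipping (flipIndex_spec k).2.2
  · rintro (k | k) α hα β hβ h
    · refine missingOne_of_mul (fun total x y hx hk => ?_) h
      rcases eq_or_reverse_of_total hn (ODI_le_MDI n hα) total with hid | hrev
      · rwa [← hid x y hx]
      -- The reversal is not order-preserving, as the images of `0` and `1` show; the only total map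
      -- is the identity.
      · exfalso
        obtain ⟨u, hu⟩ := total ⟨0, by omega⟩
        obtain ⟨v, hv⟩ := total ⟨1, by omega⟩
        have h1 := hrev _ _ hu
        have h2 := hrev _ _ hv
        have h3 := hα.2 _ _ _ _ hu hv (by simp [Fin.le_def])
        rw [Fin.le_def] at h3
        dsimp only at h1 h2
        omega
    · exact flipping_of_mul (by omega) hα.1 h
  · have cross : ∀ k l, ∀ α ∈ ODI n, α ∈ missingOne {k} → α ∉ flipping n (flipIndex n l) :=
      fun k l α hα h h' => not_hasThirdPoint_of_flipping (by omega) (flipIndex_spec l).2.2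
        (ODI_le_MDI n hα) h' (hasThirdPoint_of_missingOne hn h)
    rintro (k | k) (l | l) α hα h h'
    · obtain ⟨v, rfl, rfl⟩ := exists_mem_of_missingOne h h'
      rfl
    · exact absurd h' (cross k l α hα h)
    · exact absurd h (cross l k α hα h')
    · exact congrArg Sum.inr (flipIndex_injective n (flipping_disjoint (by omega)
        (flipIndex_spec k).2.2 (flipIndex_spec l).2.2 (ODI_le_MDI n hα) h h'))

theorem hasMonoidRank_MDI {n : ℕ} (hn : 4 ≤ n) :
    HasMonoidRank (MDI n) (2 + 3 * ((n - 1) / 2)) := by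
  classical
  let ι := Unit ⊕ Fin ((n - 1) / 2 + 1) ⊕ (Fin ((n - 1) / 2) ⊕ Fin ((n - 1) / 2))
  let emb : Fin ((n - 1) / 2 + 1) → Fin n := fun k => ⟨k.1, by omega⟩
  let gen : ι → (Fin n ≃. Fin n) := Sum.elim (fun _ => reversal n) (Sum.elim
    (fun k => if k.1 = 0 then shift n 1 else partialId {emb k}ᶜ)
    (fun k => cycleFlip n (flipIndex n k)))
  -- The orbits of the reversal; for odd `n` the last one is the midpoint alone.
  let K : Fin ((n - 1) / 2 + 1) → Set (Fin n) := fun k => {v | v.1 = k.1 ∨ v.1 + k.1 + 1 = n}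
  let A : ι → Set (Fin n ≃. Fin n) := Sum.elim (fun _ => totalNonOne (Fin n))
    (Sum.elim (fun k => missingOne (K k)) (fun k => flipping n (flipIndex n k)))
  have hcard : Fintype.card ι = 2 + 3 * ((n - 1) / 2) := by
    simp only [ι, Fintype.card_sum, Fintype.card_fin, Fintype.card_unit]
    omega
  rw [← hcard]
  have hgen : ∀ i, gen i ∈ Submonoid.closure (Set.range gen) := fun i =>
    Submonoid.subset_closure ⟨i, rfl⟩
  refine hasMonoidRank_of_family (MDI n) gen A (le_antisymm ?_ ?_) ?_ ?_ ?_ ?_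
  · rw [Submonoid.closure_le]
    rintro _ ⟨_ | k | k, rfl⟩ <;> simp only [gen, Sum.elim_inl, Sum.elim_inr]
    · exact reversal_mem_MDI (by omega)
    · split_ifs
      exacts [ODI_le_MDI n (shift_mem_ODI (by omega) _),
        ODI_le_MDI n (partialId_mem_ODI (by omega) _)]
    · exact ODI_le_MDI n (cycleFlip_mem_ODI (by omega) _)
  · have hr : reversal n ∈ Submonoid.closure (Set.range gen) := hgen (Sum.inl ())
    have hs : shift n 1 ∈ Submonoid.closure (Set.range gen) := by
      simpa [gen] using hgen (Sum.inr (Sum.inl ⟨0, by omega⟩))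
    have hs' : shift n (-1) ∈ Submonoid.closure (Set.range gen) := by
      rw [← reversal_conj_shift_one]
      exact Submonoid.mul_mem _ (Submonoid.mul_mem _ hr hs) hr
    have he : ∀ v : Fin n, v.1 ≤ (n - 1) / 2 →
        partialId {v}ᶜ ∈ Submonoid.closure (Set.range gen) := by
      intro v hv
      by_cases h0 : v.1 = 0
      · rw [← shift_neg_one_mul_shift_one h0]
        exact Submonoid.mul_mem _ hs' hs
      · have h := hgen (Sum.inr (Sum.inl ⟨v.1, by omega⟩))
        simp only [gen, emb, Sum.elim_inr, Sum.elim_inl] at h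
        rwa [if_neg h0] at h
    have hODI : ODI n ≤ Submonoid.closure (Set.range gen) := by
      refine ODI_le_of_mem (by omega) (fun v => ?_) hs hs' fun i hi hin hne => ?_
      · by_cases hv : v.1 ≤ (n - 1) / 2
        · exact he v hv
        · have hlt : n - 1 - v.1 < n := by omega
          rw [← reversal_conj_partialId (v := ⟨n - 1 - v.1, hlt⟩) (by dsimp only; omega)]
          exact Submonoid.mul_mem _ (Submonoid.mul_mem _ hr (he _ (by dsimp only; omega))) hr
      · obtain ⟨k, rfl⟩ := exists_flipIndex hi hin hne
        exact hgen (Sum.inr (Sum.inr k))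
    rintro α ⟨hα, ho | ho⟩
    · exact hODI ⟨hα, ho⟩
    · rw [← mul_one α, ← reversal_mul_reversal, ← mul_assoc]
      exact Submonoid.mul_mem _ (hODI (mul_reversal_mem_ODI (by omega) hα ho)) hr
  · rintro (_ | k | k) <;> simp only [gen, A, Sum.elim_inl, Sum.elim_inr]
    · refine ⟨fun x => ⟨⟨n - 1 - x.1, by omega⟩, ?_⟩, fun h => ?_⟩
      · rw [reversal_eq_some_iff]
        dsimp only
        omega
      · have h1 := (PEquiv.one_eq_some_iff (⟨0, by omega⟩ : Fin n) _).2 rfl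
        rw [← h, reversal_eq_some_iff] at h1
        dsimp only at h1
        omega
    · split_ifs with h0
      -- `shift n 1` omits `n - 1`, which shares the orbit of `0`.
      · exact shift_one_mem_missingOne (k := ⟨n - 1, by omega⟩)
          (Or.inr (by dsimp only; omega)) (by dsimp only; omega)
      · exact partialId_mem_missingOne (Or.inl rfl)
    · exact cycleFlip_mem_flipping (flipIndex_spec k).1 (flipIndex_spec k).2.1
  · rintro (_ | k | k)
    · exact one_notMem_totalNonOne
    · exact one_notMem_missingOne _
    · exact one_notMem_flipping (flipIndex_spec k).2.2
  · rintro (_ | k | k) α hα β hβ h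
    · exact totalNonOne_of_mul h
    · refine missingOne_of_mul (fun total x y hx hk => ?_) h
      rcases eq_or_reverse_of_total hn hα total with hid | hrev
      · rwa [← hid x y hx]
      · have := hrev x y hx
        simp only [K, Set.mem_ofPred_eq] at hk ⊢
        omega
    · exact flipping_of_mul (by omega) hα.1 h
  · have cross : ∀ l, ∀ α ∈ MDI n, HasThirdPoint α → α ∉ flipping n (flipIndex n l) :=
      fun l α hα h h' => not_hasThirdPoint_of_flipping (by omega) (flipIndex_spec l).2.2 hα h' h
    rintro (_ | k | k) (_ | l | l) α hα h h'
    · rfl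
    · exact absurd h' (notMem_missingOne_of_total h.1 _)
    · exact absurd h' (cross l α hα (hasThirdPoint_of_total hn h.1))
    · exact absurd h (notMem_missingOne_of_total h'.1 _)
    · obtain ⟨v, hk, hl⟩ := exists_mem_of_missingOne h h'
      simp only [K, Set.mem_ofPred_eq] at hk hl
      obtain rfl : k = l := by omega
      rfl
    · exact absurd h' (cross l α hα (hasThirdPoint_of_missingOne hn h))
    · exact absurd h (cross k α hα (hasThirdPoint_of_total hn h'.1))
    · exact absurd h (cross k α hα (hasThirdPoint_of_missingOne hn h'))
    · exact congrArg (Sum.inr ∘ Sum.inr) (flipIndex_injective n (flipping_disjoint (by omega)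
        (flipIndex_spec k).2.2 (flipIndex_spec l).2.2 hα h h'))

theorem hasMonoidRank_OPDI {n : ℕ} (hn : 4 ≤ n) :
    HasMonoidRank (OPDI n) (2 + (n - 1) / 2) := by
  let ι := Unit ⊕ Unit ⊕ Fin ((n - 1) / 2)
  let z : Fin n := ⟨0, by omega⟩
  let gen : ι → (Fin n ≃. Fin n) := Sum.elim (fun _ => cycleRotation n 1) (Sum.elim
    (fun _ => partialId {z}ᶜ) (fun k => cycleFlip n (k.1 + 1)))
  let A : ι → Set (Fin n ≃. Fin n) := Sum.elim (fun _ => totalNonOne (Fin n))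
    (Sum.elim (fun _ => missingOne Set.univ) (fun k => nonRotating n (k.1 + 1)))
  have hcard : Fintype.card ι = 2 + (n - 1) / 2 := by
    simp only [ι, Fintype.card_sum, Fintype.card_fin, Fintype.card_unit]
    omega
  rw [← hcard]
  have hgen : ∀ i, gen i ∈ Submonoid.closure (Set.range gen) := fun i =>
    Submonoid.subset_closure ⟨i, rfl⟩
  refine hasMonoidRank_of_family (OPDI n) gen A (le_antisymm ?_ ?_) ?_ ?_ ?_ ?_
  · rw [Submonoid.closure_le]
    rintro _ ⟨_ | _ | k, rfl⟩
    exacts [cycleRotation_mem_OPDI (by omega) 1, partialId_mem_OPDI (by omega) _,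
      cycleFlip_mem_OPDI (by omega) _]
  · refine OPDI_le_of_mem (by omega) ⟨z, hgen (Sum.inr (Sum.inl ()))⟩ (hgen (Sum.inl ()))
      fun i hi hin => ?_
    have := hgen (Sum.inr (Sum.inr ⟨i - 1, by omega⟩))
    simpa only [gen, Sum.elim_inr, Nat.sub_add_cancel hi] using this
  · rintro (_ | _ | k)
    · refine ⟨fun x => ?_, fun h => ?_⟩
      · simp only [gen, Sum.elim_inl, cycleRotation_eq_some_iff]
        by_cases hx : x.1 + 1 < n
        · exact ⟨⟨x.1 + 1, hx⟩, Or.inl rfl⟩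
        · exact ⟨z, Or.inr (by simp only [z]; omega)⟩
      · have h1 := (PEquiv.one_eq_some_iff z z).2 rfl
        rw [← h] at h1
        simp only [gen, Sum.elim_inl, cycleRotation_eq_some_iff] at h1
        omega
    · exact partialId_mem_missingOne (Set.mem_univ z)
    · exact cycleFlip_mem_nonRotating (by omega) (by omega)
  · rintro (_ | _ | k)
    exacts [one_notMem_totalNonOne, one_notMem_missingOne _, one_notMem_nonRotating]
  · rintro (_ | _ | k) α hα β hβ h
    -- Rotations act transitively on the points, so only the stable set of all points is needed
    -- here.
    exacts [totalNonOne_of_mul h, missingOne_of_mul (fun _ _ _ _ _ => Set.mem_univ _) h,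
      nonRotating_of_mul (by omega) hα.1 h]
  · have cross : ∀ l, ∀ α ∈ OPDI n, HasThirdPoint α → α ∉ nonRotating n l :=
      fun l α hα h h' => not_hasThirdPoint_of_nonRotating (by omega) hα h' h
    rintro (_ | _ | k) (_ | _ | l) α hα h h'
    · rfl
    · exact absurd h' (notMem_missingOne_of_total h.1 _)
    · exact absurd h' (cross _ α hα (hasThirdPoint_of_total hn h.1))
    · exact absurd h (notMem_missingOne_of_total h'.1 _)
    · rfl
    · exact absurd h' (cross _ α hα (hasThirdPoint_of_missingOne hn h))
    · exact absurd h (cross _ α hα (hasThirdPoint_of_total hn h'.1))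
    · exact absurd h (cross _ α hα (hasThirdPoint_of_missingOne hn h'))
    · have := nonRotating_disjoint (by omega) (by omega) (by omega) hα h h'
      obtain rfl : k = l := by omega
      rfl

theorem theorem4p3 (n : ℕ) (hn : 4 ≤ n) :
    HasMonoidRank (ODI n) (n + 2 * ((n - 1) / 2)) ∧
    HasMonoidRank (MDI n) (2 + 3 * ((n - 1) / 2)) ∧
    HasMonoidRank (OPDI n) (2 + (n - 1) / 2) :=
  ⟨hasMonoidRank_ODI hn, hasMonoidRank_MDI hn, hasMonoidRank_OPDI hn⟩
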